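/- Let $E$ be a Polish space with a compatible metric and Borel $\sigma$-algebra, and let $(X_t)_{t\ge 0}$ be a time-homogeneous, right-continuous, progressively measurable Markov process with values in $E$ on a filtered measurable space $(\Omega,\mathcal F,(\mathcal F_t)_{t\ge0})$ (for instance with its natural filtration), with laws $(\mathbb P_x)_{x\in E}$, $\mathbb P_x(X_0=x)=1$, and transition function $P_t(x,\cdot)$. Suppose that it is non-explosive ($X_t\in E$ for all $t\ge 0$, and $P_t(x,E)=1$) and ergodic: there is a unique invariant probability measure $\pi$, and $\lim_{t\to\infty}\|P_t(x,\cdot)-\pi\|_{\mathrm{Var}}=0$ for all $x\in E$. For measurable $f:E\to\mathbb R$ write $f\in D_w(L)$ with $Lf=g$ if $g:E\to\mathbb R$ is measurable and, under every $\mathbb P_x$, almost surely $\int_0^t|g(X_s)|\,ds<\infty$ for all $t\ge 0$, and $$f(X_t)-f(X_0)-\int_0^t g(X_s)\,ds,\qquad t\ge 0,$$ is a local martingale (with a.s. right-continuous paths) with respect to $(\mathcal F_t)_{t\ge0}$. Let $(E_n)_{n\ge1}$ be an increasing sequence of bounded open sets with $\bigcup_n E_n=E$, and let $H\subset E_1$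 be a closed set with $\pi(H)>0$. Suppose that for each $n\ge 1$ there is a non-negative function $u_n\in D_w(L)$ such that (a) $Lu_n(x)\ge -1$ for all $x\in E_n\setminus H$; (b) $u_n(x)=0$ for all $x\in E_n^c\cup H$, and $u_n$ is bounded on $E_n\setminus H$; and such that (c) $\sup_{x\notin H}\limsup_{n\to\infty}u_n(x)=\infty$. Then $(X_t)_{t\ge0}$ is not strongly ergodic: there are no $\varepsilon>0$, $C>0$ and invariant probability measure $\pi'$ such that $\sup_{x\in E}\|P_t(x,\cdot)-\pi'\|_{\mathrm{Var}}\le Ce^{-\varepsilon t}$ for all $t\ge0$. -/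

import Mathlib

open MeasureTheory ProbabilityTheory Filter Topology Set
open scoped NNReal ENNReal

/-- The family `P x`, `x : E`, of probability measures on `Ω` makes `X` a time-homogeneous,
right-continuous, progressively measurable Markov process with respect to the filtration `𝓕`,
started from `x` under `P x`, with transition function `κ t x A` (for instance, `𝓕` may be the
natural filtration of `X`). As `X t` takes values in `E` at all times `t` and the
kernels `κ t` have mass one, the process has infinite lifetime: it is non-explosive. -/
structure IsMarkovProcess {E Ω : Type*} [TopologicalSpace E] [MeasurableSpace E]
    {mΩ : MeasurableSpace Ω} (𝓕 : Filtration ℝ≥0 mΩ) (X : ℝ≥0 → Ω → E) (P : E → Measure Ω)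
    (κ : ℝ≥0 → Kernel E E) [∀ t, IsMarkovKernel (κ t)] : Prop where
  isProbabilityMeasure : ∀ x, IsProbabilityMeasure (P x)
  progMeasurable : IsStronglyProgressive 𝓕 X
  right_continuous : ∀ ω t, ContinuousWithinAt (fun s => X s ω) (Ici t) t
  start : ∀ x, ∀ᵐ ω ∂(P x), X 0 ω = x
  markov : ∀ (x : E) (s t : ℝ≥0) (A : Set E), MeasurableSet A →
    (P x)[(X (s + t) ⁻¹' A).indicator (fun _ => (1 : ℝ)) | 𝓕 s]
      =ᵐ[P x] fun ω => (κ t (X s ω)).real A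

/-- Total variation norm `‖μ - ν‖` of the signed measure `μ - ν`. -/
noncomputable def tvNorm {E : Type*} [MeasurableSpace E] (μ ν : Measure E)
    [IsFiniteMeasure μ] [IsFiniteMeasure ν] : ℝ≥0∞ :=
  (μ.toSignedMeasure - ν.toSignedMeasure).totalVariation univ

/-- `π` is a probability measure that is invariant for the transition function `κ`. -/
structure IsInvariantProbability {E : Type*} [MeasurableSpace E] (κ : ℝ≥0 → Kernel E E)
    (π : Measure E) : Prop where
  isProbabilityMeasure : IsProbabilityMeasure π
  invariant : ∀ t, 0 < t → (κ t).Invariant π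

/-- The process with transition function `κ` is ergodic and `π` is its unique invariant
probability measure: `‖κ t x - π‖ → 0` as `t → ∞`, for every `x`. -/
def IsErgodic {E : Type*} [MeasurableSpace E] (κ : ℝ≥0 → Kernel E E) [∀ t, IsMarkovKernel (κ t)]
    (π : Measure E) [IsProbabilityMeasure π] : Prop :=
  IsInvariantProbability κ π ∧ (∀ ν : Measure E, IsInvariantProbability κ ν → ν = π) ∧
    ∀ x, Tendsto (fun t => tvNorm (κ t x) π) atTop (𝓝 0)

/-- Strong (uniform) ergodicity of the process with transition function `κ`. -/
def IsStronglyErgodic {E : Type*} [MeasurableSpace E] (κ : ℝ≥0 → Kernel E E)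
    [∀ t, IsMarkovKernel (κ t)] : Prop :=
  ∃ ε : ℝ, 0 < ε ∧ ∃ C : ℝ, 0 < C ∧ ∃ (π : Measure E) (_ : IsProbabilityMeasure π),
    IsInvariantProbability κ π ∧
      ∀ t : ℝ≥0, ⨆ x, tvNorm (κ t x) π ≤ ENNReal.ofReal (C * Real.exp (-ε * t))

/-- `M` is a local martingale. As usual in continuous time, the paths are almost surely
right-continuous (the left limits then exist almost surely). -/
def IsLocalMartingale {Ω : Type*} {mΩ : MeasurableSpace Ω} (M : ℝ≥0 → Ω → ℝ)
    (𝓕 : Filtration ℝ≥0 mΩ) (μ : Measure Ω) : Prop :=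
  Locally (fun N => Martingale N 𝓕 μ) 𝓕 M μ ∧
    ∀ᵐ ω ∂μ, ∀ t, ContinuousWithinAt (fun s => M s ω) (Ici t) t

/-- `f` belongs to the domain `D_w(L)` of the extended generator `L` of the process, with
`L f = g`: under each `P x`, the process `f (X t) - f (X 0) - ∫₀ᵗ g (X s) ds` is well defined
and a local martingale. -/
structure IsExtendedGenerator {E Ω : Type*} [MeasurableSpace E] {mΩ : MeasurableSpace Ω}
    (𝓕 : Filtration ℝ≥0 mΩ) (X : ℝ≥0 → Ω → E) (P : E → Measure Ω) (f g : E → ℝ) : Prop where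
  measurable : Measurable f
  measurable_generator : Measurable g
  integrable : ∀ x, ∀ᵐ ω ∂(P x), ∀ t : ℝ≥0,
    IntervalIntegrable (fun s : ℝ => g (X s.toNNReal ω)) volume 0 t
  isLocalMartingale : ∀ x, IsLocalMartingale
    (fun (t : ℝ≥0) ω => f (X t ω) - f (X 0 ω) - ∫ s in (0 : ℝ)..t, g (X s.toNNReal ω)) 𝓕 (P x)

/-! Strong ergodicity gives `δ > 0` and `t₀` such that every starting point charges `H` with mass at
least `δ` at all times after `t₀`. The closed set `F = (En n)ᶜ ∪ H` inherits this, so it is reached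
in mean time at most `(t₀ + 1) / δ`, whatever `n` and the starting point. Since `u n` vanishes on
`F` and `L (u n) ≥ -1` off `F`, optional stopping bounds `u n x` by that mean time, which
contradicts (c).

The filtration need not satisfy the usual conditions, so the hitting time of `F` is replaced by the
last time `σ` of zero occupation of `F`. Progressive measurability makes `σ` optional; before `σ`
the path avoids `F` at almost every time, and at `σ` right-continuity puts it in `F`. The mean of
`σ` is controlled by `IsMarkovProcess.measureReal_occupation_le`; optional stopping is done in
`IsExtendedGenerator.le_sum_measureReal_occupation`, and `IsExtendedGenerator.le_div` combines the
two. -/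

/-- Lebesgue measure on `ℝ≥0`. -/
noncomputable def timeMeasure : Measure ℝ≥0 :=
  ((volume : Measure ℝ).restrict (Ici 0)).map Real.toNNReal

instance : SFinite timeMeasure := by unfold timeMeasure; infer_instance

lemma timeMeasure_apply {S : Set ℝ≥0} (hS : MeasurableSet S) :
    timeMeasure S = volume (Real.toNNReal ⁻¹' S ∩ Ici 0) := by
  rw [timeMeasure, Measure.map_apply measurable_real_toNNReal hS,
    Measure.restrict_apply (measurable_real_toNNReal hS)]

lemma timeMeasure_Ioc (a b : ℝ≥0) : timeMeasure (Ioc a b) = ↑(b - a) := by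
  have h : Real.toNNReal ⁻¹' Ioc a b ∩ Ici 0 = Ioc (a : ℝ) b := by
    ext r
    simp only [mem_inter_iff, mem_preimage, mem_Ioc, mem_Ici]
    constructor
    · rintro ⟨⟨h1, h2⟩, h3⟩
      exact ⟨Real.lt_toNNReal_iff_coe_lt.1 h1, Real.toNNReal_le_iff_le_coe.1 h2⟩
    · rintro ⟨h1, h2⟩
      exact ⟨⟨Real.lt_toNNReal_iff_coe_lt.2 h1, Real.toNNReal_le_iff_le_coe.2 h2⟩,
        a.2.trans h1.le⟩
  rw [timeMeasure_apply measurableSet_Ioc, h, Real.volume_Ioc, ENNReal.ofReal]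
  congr 1

lemma timeMeasure_singleton_zero : timeMeasure {0} = 0 := by
  have h : Real.toNNReal ⁻¹' {0} ∩ Ici 0 = {0} := by
    ext r
    simp only [mem_inter_iff, mem_preimage, mem_singleton_iff, mem_Ici, Real.toNNReal_eq_zero]
    exact ⟨fun h => le_antisymm h.1 h.2, fun h => by simp [h]⟩
  rw [timeMeasure_apply (measurableSet_singleton 0), h, Real.volume_singleton]

/-! ### Occupation time of a set and the last time at which it vanishes -/

section Occupation

variable {E Ω : Type*} {X : ℝ≥0 → Ω → E} {F : Set E} {ω : Ω}

/-- The Lebesgue measure of the time that the process `X` spends in `F` up to time `t`. -/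
noncomputable def occupation (X : ℝ≥0 → Ω → E) (F : Set E) (t : ℝ≥0) (ω : Ω) : ℝ≥0∞ :=
  timeMeasure {s | s ≤ t ∧ X s ω ∈ F}

lemma occupation_mono {s t : ℝ≥0} (h : s ≤ t) : occupation X F s ω ≤ occupation X F t ω :=
  measure_mono fun _ hr => ⟨hr.1.trans h, hr.2⟩

lemma occupation_zero : occupation X F 0 ω = 0 :=
  measure_mono_null (fun r hr => by simpa using hr.1) timeMeasure_singleton_zero

lemma occupation_le_add (s t : ℝ≥0) : occupation X F t ω ≤ occupation X F s ω + ↑(t - s) := by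
  rw [← timeMeasure_Ioc]
  refine (measure_mono fun r hr => ?_).trans (measure_union_le _ _)
  rcases le_or_gt r s with h | h
  · exact Or.inl ⟨h, hr.2⟩
  · exact Or.inr ⟨h, hr.1⟩

/-- The last time before `T` up to which the occupation time of `F` vanishes. -/
noncomputable def lastZeroOccupation (X : ℝ≥0 → Ω → E) (F : Set E) (T : ℝ≥0) (ω : Ω) : ℝ≥0 :=
  sSup {s | s ≤ T ∧ occupation X F s ω = 0}

lemma bddAbove_zeroOccupation (X : ℝ≥0 → Ω → E) (F : Set E) (T : ℝ≥0) (ω : Ω) :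
    BddAbove {s | s ≤ T ∧ occupation X F s ω = 0} := ⟨T, fun _ h => h.1⟩

lemma lastZeroOccupation_le (T : ℝ≥0) : lastZeroOccupation X F T ω ≤ T :=
  csSup_le ⟨0, zero_le, occupation_zero⟩ fun _ h => h.1

/-- The occupation time is 1-Lipschitz in time, so the supremum is attained. -/
lemma occupation_lastZeroOccupation (T : ℝ≥0) :
    occupation X F (lastZeroOccupation X F T ω) ω = 0 := by
  refine le_antisymm (ENNReal.le_of_forall_pos_le_add fun ε hε _ => ?_) zero_le
  obtain ⟨s, hs, h⟩ : ∃ s ∈ {s | s ≤ T ∧ occupation X F s ω = 0},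
      lastZeroOccupation X F T ω ≤ s + ε := by
    by_contra! hcon
    have h1 : lastZeroOccupation X F T ω ≤ lastZeroOccupation X F T ω - ε :=
      csSup_le ⟨0, zero_le, occupation_zero⟩ fun s hs => le_tsub_of_add_le_right (hcon s hs).le
    -- The time `0` shows that the supremum exceeds `ε`, so the truncated subtraction really
    -- decreases it.
    have h2 := hcon 0 ⟨zero_le, occupation_zero⟩
    exact absurd h1 (not_le.2 (tsub_lt_self (by simpa using hε.trans (by simpa using h2)) hε))
  refine (occupation_le_add s _).trans ?_
  rw [hs.2]
  gcongr
  exact tsub_le_iff_left.2 h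

lemma le_lastZeroOccupation {T t : ℝ≥0} (ht : t ≤ T) (h : occupation X F t ω = 0) :
    t ≤ lastZeroOccupation X F T ω :=
  le_csSup (bddAbove_zeroOccupation X F T ω) ⟨ht, h⟩

lemma lastZeroOccupation_lt_iff {T t : ℝ≥0} (ht : t ≤ T) :
    lastZeroOccupation X F T ω < t ↔ occupation X F t ω ≠ 0 := by
  refine ⟨fun h h0 => absurd h (not_lt.2 (le_lastZeroOccupation ht h0)), fun h => ?_⟩
  by_contra! hle
  exact h (le_antisymm ((occupation_mono hle).trans (occupation_lastZeroOccupation T).le) zero_le)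

/-- If `X` has a right-continuous path and `F` is closed, then `X` is in `F` at the last time of
zero occupation, unless that is the end of the time interval. -/
lemma mem_of_occupation_ne_zero [TopologicalSpace E] (hF : IsClosed F)
    (hX : ∀ t, ContinuousWithinAt (fun s => X s ω) (Ici t) t) {T : ℝ≥0}
    (h : occupation X F T ω ≠ 0) : X (lastZeroOccupation X F T ω) ω ∈ F := by
  by_contra hmem
  set σ := lastZeroOccupation X F T ω
  have hσT : σ < T := (lastZeroOccupation_lt_iff le_rfl).2 h
  have h1 : ∀ᶠ s in 𝓝[≥] σ, X s ω ∈ Fᶜ := (hX σ) (hF.isOpen_compl.mem_nhds hmem)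
  obtain ⟨v, hv, hsub⟩ := (mem_nhdsGE_iff_exists_Ico_subset' hσT).1 h1
  -- If the path were off `F` at `σ`, it would stay off `F` a little longer, and the occupation time
  -- would still vanish at `w > σ`.
  obtain ⟨w, hw1, hw2⟩ := exists_between (lt_min (show σ < v from hv) hσT)
  have hw : occupation X F w ω = 0 := by
    refine measure_mono_null (fun r hr => ?_)
      (occupation_lastZeroOccupation (X := X) (F := F) (ω := ω) T)
    refine ⟨?_, hr.2⟩
    by_contra! hr'
    exact hsub ⟨hr'.le, hr.1.trans_lt (hw2.trans_le (min_le_left _ _))⟩ hr.2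
  exact absurd hw1 (not_lt.2 (le_lastZeroOccupation (hw2.le.trans (min_le_right _ _)) hw))

lemma ae_notMem_of_occupation_eq_zero [MeasurableSpace E] (hX : Measurable fun s => X s ω)
    (hF : MeasurableSet F) {t : ℝ≥0} (h : occupation X F t ω = 0) :
    ∀ᵐ s : ℝ, s ∈ Ioc 0 (t : ℝ) → X s.toNNReal ω ∉ F := by
  have hmeas : MeasurableSet {s | s ≤ t ∧ X s ω ∈ F} := measurableSet_Iic.inter (hX hF)
  rw [occupation, timeMeasure_apply hmeas] at h
  rw [ae_iff]
  refine measure_mono_null (fun s hs => ?_) h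
  simp only [mem_ofPred_eq, Classical.not_imp, not_not] at hs
  exact ⟨⟨Real.toNNReal_le_iff_le_coe.2 hs.1.2, hs.2⟩, hs.1.1.le⟩

/-- The σ-algebra `m` is free because adaptedness needs `𝓕 t`, while Fubini under `P x` needs the
ambient one. -/
lemma measurableSet_le_inter_preimage {mΩ m : MeasurableSpace Ω} [TopologicalSpace E]
    [TopologicalSpace.PseudoMetrizableSpace E]
    [MeasurableSpace E] [BorelSpace E] {𝓕 : Filtration ℝ≥0 mΩ} (hX : IsStronglyProgressive 𝓕 X)
    (hF : MeasurableSet F) {t : ℝ≥0} (hm : 𝓕 t ≤ m) :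
    MeasurableSet[Prod.instMeasurableSpace (m₂ := m)]
      {p : ℝ≥0 × Ω | p.1 ≤ t ∧ X p.1 p.2 ∈ F} := by
  have h1 : MeasurableSet[Prod.instMeasurableSpace (m₂ := m)]
      {p : Iic t × Ω | X p.1 p.2 ∈ F} :=
    sup_le_sup le_rfl (MeasurableSpace.comap_mono hm) _ ((hX t).measurable hF)
  let : MeasurableSpace Ω := m
  have h2 : MeasurableEmbedding (Prod.map (Subtype.val : Iic t → ℝ≥0) (id : Ω → Ω)) :=
    (MeasurableEmbedding.subtype_coe measurableSet_Iic).prodMap MeasurableEmbedding.id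
  convert h2.measurableSet_image.2 h1 using 1
  ext ⟨r, w⟩
  simp [and_comm]

lemma measurable_occupation {mΩ : MeasurableSpace Ω} [TopologicalSpace E]
    [TopologicalSpace.PseudoMetrizableSpace E]
    [MeasurableSpace E] [BorelSpace E] {𝓕 : Filtration ℝ≥0 mΩ} (hX : IsStronglyProgressive 𝓕 X)
    (hF : MeasurableSet F) (t : ℝ≥0) : Measurable[𝓕 t] (occupation X F t) := by
  let : MeasurableSpace Ω := 𝓕 t
  exact measurable_measure_prodMk_right (measurableSet_le_inter_preimage hX hF le_rfl)

lemma measurableSet_occupation_eq_zero {mΩ : MeasurableSpace Ω} [TopologicalSpace E]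
    [TopologicalSpace.PseudoMetrizableSpace E]
    [MeasurableSpace E] [BorelSpace E] {𝓕 : Filtration ℝ≥0 mΩ} (hX : IsStronglyProgressive 𝓕 X)
    (hF : MeasurableSet F) (t : ℝ≥0) : MeasurableSet[𝓕 t] {ω | occupation X F t ω = 0} :=
  measurable_occupation hX hF t (measurableSet_singleton 0)

/-- The last time of zero occupation is an optional time. -/
lemma measurableSet_lastZeroOccupation_lt {mΩ : MeasurableSpace Ω} [TopologicalSpace E]
    [TopologicalSpace.PseudoMetrizableSpace E]
    [MeasurableSpace E] [BorelSpace E] {𝓕 : Filtration ℝ≥0 mΩ} (hX : IsStronglyProgressive 𝓕 X)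
    (hF : MeasurableSet F) (T t : ℝ≥0) :
    MeasurableSet[𝓕 t] {ω | lastZeroOccupation X F T ω < t} := by
  rcases le_or_gt t T with h | h
  · simp only [lastZeroOccupation_lt_iff h]
    exact (measurableSet_occupation_eq_zero hX hF t).compl
  · have : {ω | lastZeroOccupation X F T ω < t} = univ :=
      eq_univ_of_forall fun ω => (lastZeroOccupation_le T).trans_lt h
    rw [this]
    exact MeasurableSet.univ

/-- The last time of zero occupation before `N * L` is at most `L` times the number of the times
`0, L, …, (N - 1) * L` with zero occupation. -/
lemma lastZeroOccupation_le_sum (L : ℝ≥0) (N : ℕ) :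
    (lastZeroOccupation X F (N * L) ω : ℝ) ≤
      ∑ n ∈ Finset.range N, L * {ω | occupation X F (n * L) ω = 0}.indicator (fun _ => (1 : ℝ)) ω := by
  induction N with
  | zero =>
    have h : lastZeroOccupation X F 0 ω = 0 := le_antisymm (lastZeroOccupation_le 0) zero_le
    simp [h]
  | succ N ih =>
    rw [Finset.sum_range_succ]
    have hle : (N : ℝ≥0) * L ≤ (N + 1 : ℕ) * L := by gcongr; simp
    -- Either the last zero time for the horizon `N * L` is `N * L` itself and grows by at most `L`,
    -- or the occupation is already positive there and extending the horizon changes nothing.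
    by_cases h : occupation X F (N * L) ω = 0
    · have h1 : lastZeroOccupation X F ((N + 1 : ℕ) * L) ω ≤ N * L + L :=
        (lastZeroOccupation_le _).trans_eq (by push_cast; ring)
      have h2 : (N : ℝ≥0) * L ≤ lastZeroOccupation X F (N * L) ω := le_lastZeroOccupation le_rfl h
      have h3 : lastZeroOccupation X F ((N + 1 : ℕ) * L) ω
          ≤ lastZeroOccupation X F (N * L) ω + L := h1.trans (by gcongr)
      have h4 : ((lastZeroOccupation X F ((N + 1 : ℕ) * L) ω : ℝ≥0) : ℝ)
          ≤ lastZeroOccupation X F (N * L) ω + L := by exact_mod_cast h3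
      rw [indicator_of_mem (show ω ∈ {ω | occupation X F (N * L) ω = 0} from h)]
      linarith
    · rw [indicator_of_notMem (show ω ∉ {ω | occupation X F (N * L) ω = 0} from h)]
      have h1 := (lastZeroOccupation_lt_iff hle).2 h
      have h2 : lastZeroOccupation X F ((N + 1 : ℕ) * L) ω ≤ lastZeroOccupation X F (N * L) ω :=
        le_lastZeroOccupation h1.le (occupation_lastZeroOccupation _)
      have h4 : ((lastZeroOccupation X F ((N + 1 : ℕ) * L) ω : ℝ≥0) : ℝ)
          ≤ lastZeroOccupation X F (N * L) ω := by exact_mod_cast h2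
      linarith

end Occupation

/-! ### Optional stopping at optional times, by approximation from the right -/

section OptionalStopping

variable {Ω : Type*} {mΩ : MeasurableSpace Ω} {μ : Measure Ω} {𝓕 : Filtration ℝ≥0 mΩ}

/-- The first point of the grid `k⁻¹ ℕ` that is strictly larger than `t`. -/
noncomputable def gridAfter (k : ℕ) (t : ℝ≥0) : ℝ≥0 := (⌊k * t⌋₊ + 1 : ℕ) / (k : ℝ≥0)

lemma lt_gridAfter {k : ℕ} (hk : 0 < k) (t : ℝ≥0) : t < gridAfter k t := by
  have hk' : (0 : ℝ≥0) < k := by exact_mod_cast hk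
  rw [gridAfter, lt_div_iff₀ hk', mul_comm]
  exact_mod_cast Nat.lt_floor_add_one ((k : ℝ≥0) * t)

lemma gridAfter_le {k : ℕ} (hk : 0 < k) (t : ℝ≥0) : gridAfter k t ≤ t + 1 / k := by
  have hk' : (0 : ℝ≥0) < k := by exact_mod_cast hk
  rw [gridAfter, div_le_iff₀ hk', add_mul, one_div, inv_mul_cancel₀ hk'.ne']
  push_cast
  gcongr
  rw [mul_comm t]
  exact Nat.floor_le zero_le

/-- The strict inequality on the right, at a grid point not exceeding `t`, is what turns an optional
time into a stopping time. -/
lemma gridAfter_le_iff {k : ℕ} (hk : 0 < k) (s t : ℝ≥0) :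
    gridAfter k s ≤ t ↔ s < (⌊k * t⌋₊ : ℝ≥0) / k := by
  have hk' : (0 : ℝ≥0) < k := by exact_mod_cast hk
  rw [gridAfter, div_le_iff₀ hk', mul_comm t, ← Nat.le_floor_iff zero_le, Nat.succ_le_iff,
    Nat.floor_lt zero_le, lt_div_iff₀ hk', mul_comm]

lemma tendsto_gridAfter (t : ℝ≥0) :
    Tendsto (fun k => gridAfter (k + 1) t) atTop (𝓝[≥] t) := by
  refine tendsto_nhdsWithin_iff.2 ⟨?_, .of_forall fun k => (lt_gridAfter k.succ_pos t).le⟩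
  have h : Tendsto (fun k : ℕ => t + 1 / ((k : ℝ≥0) + 1)) atTop (𝓝 (t + 0)) :=
    tendsto_const_nhds.add tendsto_one_div_add_atTop_nhds_zero_nat
  rw [add_zero] at h
  refine tendsto_of_tendsto_of_tendsto_of_le_of_le tendsto_const_nhds h
    (fun k => (lt_gridAfter k.succ_pos t).le) fun k => ?_
  exact_mod_cast gridAfter_le k.succ_pos t

lemma isStoppingTime_gridAfter {σ : Ω → ℝ≥0} (hσ : ∀ t, MeasurableSet[𝓕 t] {ω | σ ω < t})
    {k : ℕ} (hk : 0 < k) : IsStoppingTime 𝓕 fun ω => (gridAfter k (σ ω) : WithTop ℝ≥0) := by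
  intro t
  have hk' : (0 : ℝ≥0) < k := by exact_mod_cast hk
  simp only [WithTop.coe_le_coe, gridAfter_le_iff hk]
  refine 𝓕.mono ?_ _ (hσ _)
  rw [div_le_iff₀ hk', mul_comm t]
  exact Nat.floor_le zero_le

/-- **Optional stopping** of a right-continuous martingale at a bounded optional time. -/
lemma MeasureTheory.Martingale.integral_optionalTime [IsFiniteMeasure μ] {N : ℝ≥0 → Ω → ℝ}
    (hN : Martingale N 𝓕 μ)
    (hcont : ∀ᵐ ω ∂μ, ∀ t, ContinuousWithinAt (fun s => N s ω) (Ici t) t)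
    {σ : Ω → ℝ≥0} (hσ : ∀ t, MeasurableSet[𝓕 t] {ω | σ ω < t}) {T : ℝ≥0} (hT : ∀ ω, σ ω ≤ T) :
    Integrable (fun ω => N (σ ω) ω) μ ∧ ∫ ω, N (σ ω) ω ∂μ = ∫ ω, N 0 ω ∂μ := by
  have hτ (k : ℕ) := isStoppingTime_gridAfter hσ k.succ_pos
  have hle (k : ℕ) (ω : Ω) : (gridAfter (k + 1) (σ ω) : WithTop ℝ≥0) ≤ ((T + 1 : ℝ≥0) : WithTop ℝ≥0) := by
    refine WithTop.coe_le_coe.2 ((gridAfter_le k.succ_pos _).trans (add_le_add (hT ω) ?_))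
    refine div_le_one_of_le₀ ?_ zero_le
    simp
  have hrange (k : ℕ) : (range fun ω => (gridAfter (k + 1) (σ ω) : WithTop ℝ≥0)).Countable := by
    refine (countable_range fun n : ℕ =>
      (((n + 1 : ℕ) / ((k + 1 : ℕ) : ℝ≥0) : ℝ≥0) : WithTop ℝ≥0)).mono ?_
    rintro _ ⟨ω, rfl⟩
    exact ⟨_, rfl⟩
  have hcond (k : ℕ) : (fun ω => N (gridAfter (k + 1) (σ ω)) ω) =ᵐ[μ]
      μ[N (T + 1) | (hτ k).measurableSpace] := by
    exact hN.stoppedValue_ae_eq_condExp_of_le_const_of_countable_range (hτ k) (hle k) (hrange k)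
  -- The stopped values are conditional expectations of the single variable `N (T + 1)`, hence
  -- uniformly integrable; with right-continuity this gives convergence in `L¹`.
  have hUI : UniformIntegrable (fun (k : ℕ) ω => N (gridAfter (k + 1) (σ ω)) ω) 1 μ :=
    ((hN.integrable (T + 1)).uniformIntegrable_condExp
      fun k => (hτ k).measurableSpace_le).ae_eq fun k => (hcond k).symm
  have hlim : ∀ᵐ ω ∂μ, Tendsto (fun k : ℕ => N (gridAfter (k + 1) (σ ω)) ω) atTop
      (𝓝 (N (σ ω) ω)) := by
    filter_upwards [hcont] with ω hω
    exact (hω (σ ω)).tendsto.comp (tendsto_gridAfter _)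
  have hmem : MemLp (fun ω => N (σ ω) ω) 1 μ := hUI.memLp_of_ae_tendsto hlim
  have hLp := tendsto_Lp_finite_of_tendsto_ae le_rfl ENNReal.one_ne_top hUI.1 hmem
    hUI.unifIntegrable hlim
  refine ⟨memLp_one_iff_integrable.1 hmem, ?_⟩
  have h1 : Tendsto (fun k : ℕ => ∫ ω, N (gridAfter (k + 1) (σ ω)) ω ∂μ) atTop
      (𝓝 (∫ ω, N (σ ω) ω ∂μ)) :=
    tendsto_integral_of_L1' _ hmem.aestronglyMeasurable
      (.of_forall fun k => memLp_one_iff_integrable.1 (hUI.memLp k)) hLp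
  have h2 (k : ℕ) : ∫ ω, N (gridAfter (k + 1) (σ ω)) ω ∂μ = ∫ ω, N 0 ω ∂μ := by
    rw [integral_congr_ae (hcond k), integral_condExp (hτ k).measurableSpace_le,
      ← integral_condExp (𝓕.le 0), integral_congr_ae (hN.condExp_ae_eq zero_le)]
  simp only [h2] at h1
  exact tendsto_nhds_unique h1 tendsto_const_nhds

end OptionalStopping

/-! ### Geometric decay of the probability of zero occupation -/

section Markov

variable {E Ω : Type*} {X : ℝ≥0 → Ω → E} {F : Set E} {mΩ : MeasurableSpace Ω} [TopologicalSpace E]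
  [TopologicalSpace.PseudoMetrizableSpace E]
  [MeasurableSpace E] [BorelSpace E] {𝓕 : Filtration ℝ≥0 mΩ} {P : E → Measure Ω}
  {κ : ℝ≥0 → Kernel E E} [∀ t, IsMarkovKernel (κ t)]

lemma IsMarkovProcess.mul_measureReal_le (hX : IsMarkovProcess 𝓕 X P κ)
    (hF : MeasurableSet F) {δ : ℝ} {t : ℝ≥0} (hδ : ∀ y, δ ≤ (κ t y).real F) (x : E) (s : ℝ≥0)
    {G : Set Ω} (hG : MeasurableSet[𝓕 s] G) :
    δ * (P x).real G ≤ (P x).real (X (s + t) ⁻¹' F ∩ G) := by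
  have := hX.isProbabilityMeasure x
  have hXm : Measurable (X (s + t)) :=
    ((hX.progMeasurable.stronglyAdapted (s + t)).measurable).mono (𝓕.le _) le_rfl
  have hG' := 𝓕.le s _ hG
  have h1 : ∫ ω in G, (X (s + t) ⁻¹' F).indicator (fun _ => (1 : ℝ)) ω ∂(P x)
      = ∫ ω in G, (κ t (X s ω)).real F ∂(P x) := by
    rw [← setIntegral_condExp (𝓕.le s) ((integrable_const _).indicator (hXm hF)) hG]
    exact setIntegral_congr_ae hG' ((hX.markov x s t F hF).mono fun ω h _ => h)
  have h2 : ∫ ω in G, (X (s + t) ⁻¹' F).indicator (fun _ => (1 : ℝ)) ω ∂(P x)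
      = (P x).real (X (s + t) ⁻¹' F ∩ G) := by
    rw [integral_indicator_const _ (hXm hF), measureReal_restrict_apply (hXm hF)]
    simp
  have h3 : Integrable (fun ω => (κ t (X s ω)).real F) (P x) :=
    integrable_condExp.congr (hX.markov x s t F hF)
  rw [← h2, h1]
  calc δ * (P x).real G = ∫ _ in G, δ ∂(P x) := by simp [mul_comm]
    _ ≤ _ := integral_mono (integrable_const _) h3.integrableOn fun ω => hδ _

/-- If `F` is charged uniformly by the transition probabilities, then the probability of zero
occupation time of `F` decays by a factor in each time interval. -/
lemma IsMarkovProcess.measureReal_occupation_step (hX : IsMarkovProcess 𝓕 X P κ)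
    (hF : MeasurableSet F) {δ : ℝ} {t₀ : ℝ≥0} (hδ : ∀ t, t₀ ≤ t → ∀ y, δ ≤ (κ t y).real F) (x : E)
    (s : ℝ≥0) :
    (P x).real {ω | occupation X F (s + (t₀ + 1)) ω = 0} ≤
      (1 - δ) * (P x).real {ω | occupation X F s ω = 0} := by
  have := hX.isProbabilityMeasure x
  set T := s + (t₀ + 1) with hT
  set G := {ω | occupation X F s ω = 0}
  have hGs : MeasurableSet[𝓕 s] G := measurableSet_occupation_eq_zero hX.progMeasurable hF s
  have hG : MeasurableSet G := 𝓕.le s _ hGs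
  set G' := {ω | occupation X F T ω = 0}
  have hG' : MeasurableSet G' :=
    𝓕.le T _ (measurableSet_occupation_eq_zero hX.progMeasurable hF T)
  have hsub : G' ⊆ G := fun ω hω =>
    le_antisymm ((occupation_mono le_self_add).trans (show occupation X F T ω = 0 from hω).le) zero_le
  -- The measure of `S` is computed in both orders. Slicing in time, each slice has mass at least `δ
  -- * P(G)` by the Markov property at `s`; slicing in `ω`, the slice is null on `G'` and has length
  -- at most one elsewhere.
  set S : Set (ℝ≥0 × Ω) := {p | p.1 ≤ T ∧ X p.1 p.2 ∈ F} ∩ Prod.fst ⁻¹' Ioc (s + t₀) T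
  have hS : MeasurableSet S := by
    exact (measurableSet_le_inter_preimage hX.progMeasurable hF (𝓕.le T)).inter
      (measurable_fst measurableSet_Ioc)
  have hlower : ENNReal.ofReal (δ * (P x).real G) ≤
      (timeMeasure.prod ((P x).restrict G)) S := by
    rw [Measure.prod_apply hS]
    calc ENNReal.ofReal (δ * (P x).real G)
        = ∫⁻ _ in Ioc (s + t₀) T, ENNReal.ofReal (δ * (P x).real G) ∂timeMeasure := by
          have : T - (s + t₀) = 1 := by rw [hT, ← add_assoc, add_tsub_cancel_left]
          rw [setLIntegral_const, timeMeasure_Ioc, this]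
          simp
      _ ≤ ∫⁻ r in Ioc (s + t₀) T, ((P x).restrict G) (Prod.mk r ⁻¹' S) ∂timeMeasure := by
          refine setLIntegral_mono (measurable_measure_prodMk_left hS) fun r hr => ?_
          have hsr : s ≤ r := le_self_add.trans hr.1.le
          have hr' : s + (r - s) = r := add_tsub_cancel_of_le hsr
          have h := hX.mul_measureReal_le hF
            (hδ (r - s) (le_tsub_of_add_le_left hr.1.le)) x s hGs
          rw [hr'] at h
          refine (ENNReal.ofReal_le_ofReal h).trans ?_
          rw [ofReal_measureReal, Measure.restrict_apply (measurable_prodMk_left hS)]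
          exact measure_mono fun ω hω => ⟨⟨⟨hr.2, hω.1⟩, hr⟩, hω.2⟩
      _ ≤ _ := setLIntegral_le_lintegral _ _
  have hupper : (timeMeasure.prod ((P x).restrict G)) S ≤ P x (G \ G') := by
    rw [Measure.prod_apply_symm hS]
    calc ∫⁻ ω, timeMeasure ((fun r => (r, ω)) ⁻¹' S) ∂(P x).restrict G
        ≤ ∫⁻ ω, (G'ᶜ).indicator 1 ω ∂(P x).restrict G := by
          refine lintegral_mono fun ω => ?_
          by_cases hω : ω ∈ G'
          · exact (measure_mono_null (fun r hr => hr.1) hω).le.trans zero_le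
          · rw [indicator_of_mem hω]
            refine (measure_mono (t := Ioc (s + t₀) T) fun r hr => hr.2).trans ?_
            rw [timeMeasure_Ioc, hT, ← add_assoc, add_tsub_cancel_left]
            simp
      _ = P x (G \ G') := by
          rw [lintegral_indicator_one hG'.compl, Measure.restrict_apply hG'.compl, inter_comm]
          rfl
  have h := ENNReal.toReal_mono (measure_ne_top _ _) (hlower.trans hupper)
  have h2 : δ * (P x).real G ≤ (P x).real (G \ G') := by
    refine (le_max_left _ 0).trans ?_
    rwa [← ENNReal.toReal_ofReal']
  rw [measureReal_sdiff hsub hG'] at h2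
  linarith

lemma IsMarkovProcess.measureReal_occupation_le (hX : IsMarkovProcess 𝓕 X P κ)
    (hF : MeasurableSet F) {δ : ℝ} (hδ1 : δ ≤ 1) {t₀ : ℝ≥0}
    (hδ : ∀ t, t₀ ≤ t → ∀ y, δ ≤ (κ t y).real F) (x : E) (n : ℕ) :
    (P x).real {ω | occupation X F (n * (t₀ + 1)) ω = 0} ≤ (1 - δ) ^ n := by
  have := hX.isProbabilityMeasure x
  induction n with
  | zero => simp
  | succ n ih =>
    have h := hX.measureReal_occupation_step hF hδ x (n * (t₀ + 1))
    have heq : ((n + 1 : ℕ) : ℝ≥0) * (t₀ + 1) = n * (t₀ + 1) + (t₀ + 1) := by push_cast; ring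
    rw [heq, pow_succ']
    exact h.trans (mul_le_mul_of_nonneg_left ih (sub_nonneg.2 hδ1))

end Markov

/-! ### Uniform lower bound from strong ergodicity -/

/-- Along a strongly ergodic process, the probability of a set of positive invariant measure is
eventually bounded away from zero, uniformly in the starting point. -/
lemma IsStronglyErgodic.exists_le_measureReal {E : Type*} [MeasurableSpace E]
    {κ : ℝ≥0 → Kernel E E} [∀ t, IsMarkovKernel (κ t)] (h : IsStronglyErgodic κ)
    {π : Measure E} (hπ : ∀ ν : Measure E, IsInvariantProbability κ ν → ν = π) {H : Set E}
    (hH : MeasurableSet H) (hπH : 0 < π H) :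
    ∃ δ : ℝ, 0 < δ ∧ ∃ t₀ : ℝ≥0, ∀ t, t₀ ≤ t → ∀ y, δ ≤ (κ t y).real H := by
  obtain ⟨ε, hε, C, hC, π', hπ', hinv, hbound⟩ := h
  -- Uniqueness transfers the positivity of `π H` to the invariant measure of the strong ergodicity
  -- bound.
  obtain rfl := hπ _ hinv
  have hpos : 0 < π'.real H := ENNReal.toReal_pos hπH.ne' (measure_ne_top _ _)
  have hlim : Tendsto (fun t : ℝ≥0 => C * Real.exp (-ε * t)) atTop (𝓝 0) := by
    rw [← mul_zero C]
    refine (Real.tendsto_exp_atBot.comp ?_).const_mul C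
    exact NNReal.tendsto_coe_atTop.2 tendsto_id |>.const_mul_atTop_of_neg (neg_lt_zero.2 hε)
  obtain ⟨t₀, ht₀⟩ := eventually_atTop.1 (hlim.eventually (gt_mem_nhds (half_pos hpos)))
  refine ⟨π'.real H / 2, half_pos hpos, t₀, fun t ht y => ?_⟩
  have h1 := (SignedMeasure.enorm_le_totalVariation
    ((κ t y).toSignedMeasure - π'.toSignedMeasure) H).trans
    ((measure_mono (subset_univ H)).trans
      ((le_iSup (fun x => tvNorm (κ t x) π') y).trans (hbound t)))
  rw [← ofReal_norm, ENNReal.ofReal_le_ofReal_iff (by positivity)] at h1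
  rw [sub_apply, Measure.toSignedMeasure_apply_measurable hH,
    Measure.toSignedMeasure_apply_measurable hH, Real.norm_eq_abs] at h1
  have := (abs_le.1 (h1.trans (ht₀ t ht).le)).1
  linarith

/-! ### Bounding functions in the domain of the extended generator -/

section Generator

variable {E Ω : Type*} {mΩ : MeasurableSpace Ω} {μ : Measure Ω} {𝓕 : Filtration ℝ≥0 mΩ}
  {X : ℝ≥0 → Ω → E}

lemma stoppedProcess_eq_min {M : ℝ≥0 → Ω → ℝ} {τ : Ω → WithTop ℝ≥0} {ω : Ω} {a : ℝ≥0}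
    (h : τ ω = a) (t : ℝ≥0) : stoppedProcess M τ t ω = M (min t a) ω := by
  rw [stoppedProcess, h, ← WithTop.coe_min]
  rfl

lemma continuousWithinAt_stoppedProcess {M : ℝ≥0 → Ω → ℝ} {τ : Ω → WithTop ℝ≥0} {ω : Ω}
    (h : ∀ t, ContinuousWithinAt (fun s => M s ω) (Ici t) t) (t : ℝ≥0) :
    ContinuousWithinAt (fun s => stoppedProcess M τ s ω) (Ici t) t := by
  cases h' : τ ω with
  | top =>
    have heq (s : ℝ≥0) : stoppedProcess M τ s ω = M s ω :=
      stoppedProcess_eq_of_le (h' ▸ le_top)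
    simpa only [heq] using h t
  | coe a =>
    simp only [stoppedProcess_eq_min h']
    exact (h (min t a)).comp (f := fun s => min s a) (by fun_prop)
      fun s hs => min_le_min_right a hs

/-- The bound of a process `f (X t) - f (X 0) - ∫₀ᵗ g (X s) ds` before the occupation time of
`F` becomes positive, if `f` is at most `C` and `g` is at least `-1` outside `F`. -/
lemma sub_sub_intervalIntegral_le [MeasurableSpace E] {F : Set E} (hF : MeasurableSet F)
    {f g : E → ℝ} (hg : ∀ y ∉ F, -1 ≤ g y) {ω : Ω} (hX : Measurable fun s => X s ω)
    {t : ℝ≥0} (hint : IntervalIntegrable (fun s : ℝ => g (X s.toNNReal ω)) volume 0 t)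
    (hocc : occupation X F t ω = 0) :
    f (X t ω) - f (X 0 ω) - ∫ s in (0 : ℝ)..t, g (X s.toNNReal ω) ≤
      f (X t ω) - f (X 0 ω) + t := by
  have h : ∫ _ in (0 : ℝ)..t, (-1 : ℝ) ≤ ∫ s in (0 : ℝ)..t, g (X s.toNNReal ω) := by
    simp only [intervalIntegral.integral_of_le t.coe_nonneg]
    refine setIntegral_mono_ae_restrict (by simp) hint.1 ?_
    filter_upwards [ae_restrict_of_ae (ae_notMem_of_occupation_eq_zero hX hF hocc),
      ae_restrict_mem measurableSet_Ioc] with s hs hs'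
    exact hg _ (hs hs')
  rw [intervalIntegral.integral_const] at h
  simp only [sub_zero, smul_eq_mul, mul_neg, mul_one] at h
  linarith

/-- This removes the localization error on a bounded time horizon. -/
lemma tendsto_measureReal_localizingSequence_le [IsFiniteMeasure μ] {τ : ℕ → Ω → WithTop ℝ≥0}
    (hτ : IsLocalizingSequence 𝓕 τ μ) (T : ℝ≥0) :
    Tendsto (fun m => μ.real {ω | τ m ω ≤ T}) atTop (𝓝 0) := by
  have hmeas (m : ℕ) : MeasurableSet {ω | τ m ω ≤ T} := 𝓕.le T _ (hτ.isStoppingTime m T)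
  have h : Tendsto (fun m => ∫ ω, {ω | τ m ω ≤ T}.indicator (fun _ => (1 : ℝ)) ω ∂μ) atTop
      (𝓝 (∫ _, (0 : ℝ) ∂μ)) := by
    refine tendsto_integral_of_dominated_convergence (fun _ => 1)
      (fun m => ((measurable_const.indicator (hmeas m)).aestronglyMeasurable))
      (integrable_const _) (fun m => .of_forall fun ω => ?_) ?_
    · refine (norm_indicator_le_norm_self _ _).trans (by simp)
    · filter_upwards [hτ.tendsto_top] with ω hω
      refine tendsto_const_nhds.congr' ?_
      filter_upwards [hω.eventually (lt_mem_nhds (WithTop.coe_lt_top T))] with m hm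
      rw [indicator_of_notMem]
      exact not_le.2 hm
  simp only [integral_indicator_const _ (hmeas _), integral_zero, smul_eq_mul, mul_one] at h
  exact h

variable [TopologicalSpace E] [TopologicalSpace.PseudoMetrizableSpace E] [MeasurableSpace E]
  [BorelSpace E] {P : E → Measure Ω} {κ : ℝ≥0 → Kernel E E} [∀ t, IsMarkovKernel (κ t)]

lemma MeasureTheory.IsStronglyProgressive.measurable_path (hX : IsStronglyProgressive 𝓕 X) (ω : Ω) :
    Measurable fun s => X s ω := by
  refine measurable_of_isOpen fun U hU => ?_
  have h (n : ℕ) : MeasurableSet {s | s ≤ (n : ℝ≥0) ∧ X s ω ∈ U} :=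
    (measurable_id.prodMk measurable_const : Measurable[_, Prod.instMeasurableSpace (m₂ := 𝓕 n)]
      fun s : ℝ≥0 => (s, ω)) (measurableSet_le_inter_preimage hX hU.measurableSet le_rfl)
  convert MeasurableSet.iUnion h using 1
  ext s
  simp only [mem_preimage, mem_iUnion, mem_ofPred_eq, exists_and_right]
  exact ⟨fun hs => ⟨exists_nat_ge s, hs⟩, fun hs => hs.2⟩

/-- A bounded function `f` in the domain of the extended generator that vanishes on a closed set
`F` and satisfies `L f ≥ -1` outside `F` is bounded by the mean time until the process has
occupied `F` for a positive time. -/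
lemma IsExtendedGenerator.le_sum_measureReal_occupation (hX : IsMarkovProcess 𝓕 X P κ)
    {F : Set E} (hF : IsClosed F) {f g : E → ℝ} (hfg : IsExtendedGenerator 𝓕 X P f g)
    (hf : ∀ y ∈ F, f y = 0) {C : ℝ} (hC : 0 ≤ C) (hfC : ∀ y, f y ≤ C) (hf0 : ∀ y, 0 ≤ f y)
    (hg : ∀ y ∉ F, -1 ≤ g y) (x : E) (L : ℝ≥0) (N : ℕ) :
    f x ≤ C * (P x).real {ω | occupation X F (N * L) ω = 0} +
      L * ∑ n ∈ Finset.range N, (P x).real {ω | occupation X F (n * L) ω = 0} := by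
  have := hX.isProbabilityMeasure x
  have hFm := hF.measurableSet
  have hprog := hX.progMeasurable
  set T : ℝ≥0 := N * L with hT
  set σ : Ω → ℝ≥0 := lastZeroOccupation X F T with hσ
  have hZ (t : ℝ≥0) : MeasurableSet {ω | occupation X F t ω = 0} :=
    𝓕.le t _ (measurableSet_occupation_eq_zero hprog hFm t)
  obtain ⟨⟨τ, hτ, hmart⟩, hcont⟩ := hfg.isLocalMartingale x
  set M : ℝ≥0 → Ω → ℝ := fun t ω =>
    f (X t ω) - f (X 0 ω) - ∫ s in (0 : ℝ)..t, g (X s.toNNReal ω) with hM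
  have hM0 (ω : Ω) : M 0 ω = 0 := by simp [hM]
  -- On `τ m ≤ T` the stopped process is only bounded by `C + σ`; the extra `f x` in the error term
  -- cancels the `-f x` of the pointwise bound `hle`.
  have hbound (m : ℕ) : f x ≤ C * (P x).real {ω | occupation X F T ω = 0} +
      L * ∑ n ∈ Finset.range N, (P x).real {ω | occupation X F (n * L) ω = 0} +
      (C + f x) * (P x).real {ω | τ m ω ≤ T} := by
    have hτm : MeasurableSet {ω | τ m ω ≤ T} := 𝓕.le T _ (hτ.isStoppingTime m T)
    obtain ⟨hNint, hNeq⟩ := (hmart m).integral_optionalTime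
      (hcont.mono fun ω hω => continuousWithinAt_stoppedProcess fun t => by
        by_cases h : ω ∈ {ω | ⊥ < τ m ω}
        · simpa only [indicator_of_mem h] using hω t
        · simpa only [indicator_of_notMem h] using continuousWithinAt_const)
      (measurableSet_lastZeroOccupation_lt hprog hFm T) (fun _ => lastZeroOccupation_le T)
    have hN0 : ∫ ω, stoppedProcess (fun i => {ω | ⊥ < τ m ω}.indicator (M i)) (τ m) 0 ω ∂P x
        = 0 := by
      refine integral_eq_zero_of_ae (.of_forall fun ω => ?_)
      have : stoppedProcess (fun i => {ω | ⊥ < τ m ω}.indicator (M i)) (τ m) 0 ω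
          = {ω | ⊥ < τ m ω}.indicator (M 0) ω := stoppedProcess_eq_of_le (by simp)
      rw [this]
      by_cases h : ω ∈ {ω | ⊥ < τ m ω}
      · rw [indicator_of_mem h, hM0, Pi.zero_apply]
      · rw [indicator_of_notMem h, Pi.zero_apply]
    rw [hN0] at hNeq
    have hint1 (t : ℝ≥0) (c : ℝ) : Integrable
        (fun ω => c * {ω | occupation X F t ω = 0}.indicator (fun _ => (1 : ℝ)) ω) (P x) :=
      ((integrable_const _).indicator (hZ t)).const_mul c
    have hint2 : Integrable
        (fun ω => (C + f x) * {ω | τ m ω ≤ T}.indicator (fun _ => (1 : ℝ)) ω) (P x) :=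
      ((integrable_const _).indicator hτm).const_mul _
    have hint3 : Integrable (fun ω => ∑ n ∈ Finset.range N,
        L * {ω | occupation X F (n * L) ω = 0}.indicator (fun _ => (1 : ℝ)) ω) (P x) :=
      integrable_finsetSum _ fun n _ => hint1 _ _
    have hle : ∀ᵐ ω ∂P x,
        stoppedProcess (fun i => {ω | ⊥ < τ m ω}.indicator (M i)) (τ m) (σ ω) ω ≤
          C * {ω | occupation X F T ω = 0}.indicator (fun _ => (1 : ℝ)) ω +
          ∑ n ∈ Finset.range N,
            L * {ω | occupation X F (n * L) ω = 0}.indicator (fun _ => (1 : ℝ)) ω +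
          (C + f x) * {ω | τ m ω ≤ T}.indicator (fun _ => (1 : ℝ)) ω - f x := by
      filter_upwards [hX.start x, hfg.integrable x] with ω hstart hint
      have hMle (t : ℝ≥0) (ht : t ≤ σ ω) : M t ω ≤ f (X t ω) - f x + σ ω := by
        have h0 : occupation X F t ω = 0 := le_antisymm
          ((occupation_mono ht).trans (occupation_lastZeroOccupation T).le) zero_le
        have h := sub_sub_intervalIntegral_le (f := f) hFm hg (hprog.measurable_path ω) (hint t) h0
        rw [hstart] at h
        have ht' : (t : ℝ) ≤ σ ω := by exact_mod_cast ht
        simp only [hM, hstart]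
        linarith
      have hsum : (σ ω : ℝ) ≤ _ := lastZeroOccupation_le_sum (X := X) (F := F) (ω := ω) L N
      have hCind : 0 ≤ C * {ω | occupation X F T ω = 0}.indicator (fun _ => (1 : ℝ)) ω :=
        mul_nonneg hC (indicator_nonneg (fun _ _ => zero_le_one) _)
      rcases le_or_gt (τ m ω) (T : WithTop ℝ≥0) with hτω | hτω
      · rw [indicator_of_mem (show ω ∈ {ω | τ m ω ≤ T} from hτω)]
        suffices h : stoppedProcess (fun i => {ω | ⊥ < τ m ω}.indicator (M i)) (τ m) (σ ω) ω
            ≤ C + σ ω by linarith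
        obtain ⟨a, ha⟩ := WithTop.ne_top_iff_exists.1 (hτω.trans_lt (WithTop.coe_lt_top T)).ne
        rw [stoppedProcess_eq_min ha.symm]
        by_cases hpos : ω ∈ {ω | ⊥ < τ m ω}
        · rw [indicator_of_mem hpos]
          -- Stopping may occur strictly before `σ`, where `f` need not vanish, so only `f ≤ C` is
          -- available.
          linarith [hMle _ (min_le_left _ a), hfC (X (min (σ ω) a) ω), hf0 x]
        · rw [indicator_of_notMem hpos]
          exact add_nonneg hC (σ ω).2
      · have hστ : (σ ω : WithTop ℝ≥0) ≤ τ m ω :=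
          (WithTop.coe_le_coe.2 (lastZeroOccupation_le T)).trans hτω.le
        have hpos : ω ∈ {ω | ⊥ < τ m ω} := bot_le.trans_lt hτω
        rw [indicator_of_notMem (show ω ∉ {ω | τ m ω ≤ T} from not_le.2 hτω),
          stoppedProcess_eq_of_le hστ, indicator_of_mem hpos]
        have hMσ := hMle _ le_rfl
        -- If the occupation up to `T` is positive, the path is in `F` at `σ` and `f` vanishes
        -- there; this confines the constant `C` to the event of zero occupation.
        have hfσ : f (X (σ ω) ω) ≤
            C * {ω | occupation X F T ω = 0}.indicator (fun _ => (1 : ℝ)) ω := by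
          by_cases h0 : occupation X F T ω = 0
          · rw [indicator_of_mem (show ω ∈ {ω | occupation X F T ω = 0} from h0), mul_one]
            exact hfC _
          · rw [hf _ (mem_of_occupation_ne_zero hF (hX.right_continuous ω) h0)]
            exact hCind
        linarith
    have hfinal := integral_mono_ae hNint
      ((((hint1 T C).add hint3).add hint2).sub (integrable_const (f x))) hle
    rw [hNeq] at hfinal
    have e1 (t : ℝ≥0) (c : ℝ) :
        ∫ ω, c * {ω | occupation X F t ω = 0}.indicator (fun _ => (1 : ℝ)) ω ∂P x
          = c * (P x).real {ω | occupation X F t ω = 0} := by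
      rw [integral_const_mul, integral_indicator_const _ (hZ t), smul_eq_mul, mul_one]
    have e2 : ∫ ω, (C + f x) * {ω | τ m ω ≤ T}.indicator (fun _ => (1 : ℝ)) ω ∂P x
          = (C + f x) * (P x).real {ω | τ m ω ≤ T} := by
      rw [integral_const_mul, integral_indicator_const _ hτm, smul_eq_mul, mul_one]
    have e3 := integral_sub' (((hint1 T C).add hint3).add hint2) (integrable_const (f x))
    have e4 := integral_add' ((hint1 T C).add hint3) hint2
    have e5 := integral_add' (hint1 T C) hint3
    have e6 := integral_finsetSum (Finset.range N) fun n _ => hint1 (n * L) L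
    simp only [e1] at e6 e5
    rw [e2] at e4
    rw [e4, e5, e6, ← Finset.mul_sum] at e3
    simp only [integral_const, probReal_univ, one_smul] at e3
    have hfinal' := hfinal.trans_eq e3
    linarith
  have hlim := ((tendsto_measureReal_localizingSequence_le hτ T).const_mul (C + f x)).const_add
    (C * (P x).real {ω | occupation X F T ω = 0} +
      L * ∑ n ∈ Finset.range N, (P x).real {ω | occupation X F (n * L) ω = 0})
  rw [mul_zero, add_zero] at hlim
  exact ge_of_tendsto' hlim hbound

/-- A bounded function `f` in the domain of the extended generator that vanishes on a closed set
`F` and satisfies `L f ≥ -1` outside `F` is bounded in terms of the uniform lower bound of the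
transition probabilities to `F`. -/
lemma IsExtendedGenerator.le_div (hX : IsMarkovProcess 𝓕 X P κ)
    {F : Set E} (hF : IsClosed F) {f g : E → ℝ} (hfg : IsExtendedGenerator 𝓕 X P f g)
    (hf : ∀ y ∈ F, f y = 0) {C : ℝ} (hC : 0 ≤ C) (hfC : ∀ y, f y ≤ C) (hf0 : ∀ y, 0 ≤ f y)
    (hg : ∀ y ∉ F, -1 ≤ g y) {δ : ℝ} (hδ0 : 0 < δ) {t₀ : ℝ≥0}
    (hδ : ∀ t, t₀ ≤ t → ∀ y, δ ≤ (κ t y).real F) (x : E) :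
    f x ≤ (t₀ + 1) / δ := by
  have hδ1 : δ ≤ 1 := (hδ t₀ le_rfl x).trans measureReal_le_one
  -- The term with `C` decays as `N → ∞`, so the final bound does not involve `C`, which will depend
  -- on `n`.
  have hbound (N : ℕ) : f x ≤ C * (1 - δ) ^ N + (t₀ + 1) / δ := by
    refine (hfg.le_sum_measureReal_occupation hX hF hf hC hfC hf0 hg x (t₀ + 1) N).trans ?_
    have hp (n : ℕ) := hX.measureReal_occupation_le hF.measurableSet hδ1 hδ x n
    have hsum : ∑ n ∈ Finset.range N, (P x).real {ω | occupation X F (n * (t₀ + 1)) ω = 0} ≤ 1 / δ := by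
      refine (Finset.sum_le_sum fun n _ => hp n).trans ?_
      have h := mul_neg_geom_sum (1 - δ) N
      -- The geometric series of ratio `1 - δ` sums to at most `1 / δ`.
      rw [sub_sub_cancel] at h
      rw [le_div_iff₀ hδ0, mul_comm, h]
      exact sub_le_self _ (pow_nonneg (sub_nonneg.2 hδ1) N)
    rw [div_eq_mul_one_div]
    refine add_le_add (mul_le_mul_of_nonneg_left (hp N) hC) ?_
    push_cast
    gcongr
  have hlim := ((tendsto_pow_atTop_nhds_zero_of_lt_one (sub_nonneg.2 hδ1)
    (sub_lt_self 1 hδ0)).const_mul C).add_const ((t₀ + 1) / δ)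
  rw [mul_zero, zero_add] at hlim
  exact ge_of_tendsto' hlim hbound

end Generator

/-! ### The contradiction with condition (c) -/

/-- The increasing sequence of bounded open sets and the functions `u` are indexed from `0`, so
that `En 0` is the first set. The function `Lu n` is `L (u n)`. -/
theorem theorem2 {E : Type*} [MetricSpace E] [PolishSpace E] [MeasurableSpace E] [BorelSpace E]
    {Ω : Type*} {mΩ : MeasurableSpace Ω} (𝓕 : Filtration ℝ≥0 mΩ)
    (X : ℝ≥0 → Ω → E) (P : E → Measure Ω)
    (κ : ℝ≥0 → Kernel E E) [∀ t, IsMarkovKernel (κ t)]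
    (hX : IsMarkovProcess 𝓕 X P κ)
    (π : Measure E) [IsProbabilityMeasure π] (hπ : IsErgodic κ π)
    (En : ℕ → Set E) (hEn_open : ∀ n, IsOpen (En n))
    (hEn_bdd : ∀ n, Bornology.IsBounded (En n))
    (hEn_mono : Monotone En) (hEn_union : ⋃ n, En n = univ)
    (H : Set E) (hH : IsClosed H) (hHE : H ⊆ En 0) (hπH : 0 < π H)
    (u Lu : ℕ → E → ℝ) (hu_nonneg : ∀ n x, 0 ≤ u n x)
    (hu_dom : ∀ n, IsExtendedGenerator 𝓕 X P (u n) (Lu n))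
    (ha : ∀ n, ∀ x ∈ En n \ H, -1 ≤ Lu n x)
    (hb_zero : ∀ n, ∀ x ∈ (En n)ᶜ ∪ H, u n x = 0)
    (hb_bdd : ∀ n, ∃ C : ℝ, ∀ x ∈ En n \ H, u n x ≤ C)
    (hc : ⨆ x ∈ Hᶜ, limsup (fun n => (u n x : EReal)) atTop = ⊤) :
    ¬ IsStronglyErgodic κ := by
  intro hse
  obtain ⟨δ, hδ0, t₀, hδ⟩ := hse.exists_le_measureReal hπ.2.1 hH.measurableSet hπH
  have hbound (n : ℕ) (x : E) : u n x ≤ (t₀ + 1) / δ := by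
    obtain ⟨C, hC⟩ := hb_bdd n
    -- The target is `(En n)ᶜ ∪ H`, which is charged at least as much as `H`. The bound is `max C 0`
    -- because `C` may be negative when `En n \ H` is empty.
    refine (hu_dom n).le_div hX ((hEn_open n).isClosed_compl.union hH) (hb_zero n)
      (le_max_right C 0) (fun y => ?_) (hu_nonneg n) (fun y hy => ?_) hδ0
      (fun t ht y => (hδ t ht y).trans (measureReal_mono subset_union_right)) x
    · by_cases hy : y ∈ (En n)ᶜ ∪ H
      · rw [hb_zero n y hy]
        exact le_max_right _ _
      · rw [mem_union, not_or, notMem_compl_iff] at hy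
        exact (hC y hy).trans (le_max_left _ _)
    · rw [mem_union, not_or, notMem_compl_iff] at hy
      exact ha n y hy
  refine absurd hc (ne_top_of_le_ne_top (EReal.coe_ne_top ((t₀ + 1) / δ)) ?_)
  exact iSup₂_le fun x _ => limsup_le_of_le (h := .of_forall fun n => EReal.coe_le_coe (hbound n x))
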